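/- For a number field $K$ with ring of integers $\mathcal{O}_K$, let $D_K$ denote the absolute value of the discriminant of $K$ over $\mathbb{Q}$. For $\alpha\in\mathcal{O}_K$ let $M(\alpha)$ be the Mahler measure of the minimal polynomial of $\alpha$ over $\mathbb{Z}$, and let $$M(\mathcal{O}_K)=\min\{M(\alpha) : \alpha\in\mathcal{O}_K,\ \mathbb{Q}(\alpha)=K\}.$$ There are infinitely many square-free integers $k>0$. For every square-free integer $k>0$, the field $K_k=\mathbb{Q}\big(\sqrt{k(5+\sqrt5)}\big)$ is a totally real cyclic quartic field (that is, totally real and Galois over $\mathbb{Q}$ with cyclic Galois group of order $4$), the minimum defining $M(\mathcal{O}_{K_k})$ is attained, and $$\tfrac{1}{1920}\,D_{K_k}^{1/2}\le M(\mathcal{O}_{K_k})\le D_{K_k}^{1/2}.$$ Hence the exponent $\tfrac12$ in the upper bound is attained by infinitely many fields and is sharp: the values $D_{K_k}$, for square-free $k>0$, form an infinite set, and for all real numbers $\theta<\tfrac12$ and $C$ there is a square-free integer $k>0$ with $M(\mathcal{O}_{K_k})>C\,D_{K_k}^{\theta}$. -/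

import Mathlib

open scoped NumberField

/-- The Mahler measure `M(α)` of an algebraic integer `α` of a number field: the Mahler measure of
its minimal polynomial over `ℤ` (monic, hence of content 1), regarded as a complex polynomial. -/
noncomputable def integerMahlerMeasure {K : Type*} [Field K] (α : 𝓞 K) : ℝ :=
  ((minpoly ℤ (α : K)).map (Int.castRingHom ℂ)).mahlerMeasure

/-- The set of Mahler measures of the integral generators of `K` over `ℚ`. -/
def integralGeneratorMahlerMeasures (K : Type*) [Field K] [NumberField K] : Set ℝ :=
  {r : ℝ | ∃ α : 𝓞 K, IntermediateField.adjoin ℚ {(α : K)} = ⊤ ∧ r = integerMahlerMeasure α}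

/-- `M(𝓞 K)`, the minimal Mahler measure of an integral generator of `K`. -/
noncomputable def minIntegralMahlerMeasure (K : Type*) [Field K] [NumberField K] : ℝ :=
  sInf (integralGeneratorMahlerMeasures K)

/-- `D_K`, the absolute value of the discriminant of `K` over `ℚ`, as a real number. -/
noncomputable def absDiscr (K : Type*) [Field K] [NumberField K] : ℝ :=
  |(NumberField.discr K : ℝ)|

/-- The field `ℚ(√(k(5 + √5)))`, as a subfield of `ℝ`. -/
noncomputable def quarticField (k : ℕ) : IntermediateField ℚ ℝ :=
  IntermediateField.adjoin ℚ {√((k : ℝ) * (5 + √5))}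

theorem isIntegral_quarticField_generator (k : ℕ) : IsIntegral ℚ √((k : ℝ) * (5 + √5)) := by
  have h5 : IsIntegral ℚ (√5 : ℝ) := by
    apply IsIntegral.of_pow (n := 2) (by norm_num)
    rw [Real.sq_sqrt (by norm_num)]
    exact_mod_cast isIntegral_algebraMap (R := ℚ) (A := ℝ) (x := 5)
  apply IsIntegral.of_pow (n := 2) (by norm_num)
  rw [Real.sq_sqrt (by positivity)]
  have hk : IsIntegral ℚ (k : ℝ) := by
    exact_mod_cast isIntegral_algebraMap (R := ℚ) (A := ℝ) (x := k)
  have h : IsIntegral ℚ (5 : ℝ) := by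
    exact_mod_cast isIntegral_algebraMap (R := ℚ) (A := ℝ) (x := 5)
  exact hk.mul (h.add h5)

instance quarticField_numberField (k : ℕ) : NumberField (quarticField k) where
  to_charZero := inferInstance
  to_finiteDimensional :=
    IntermediateField.adjoin.finiteDimensional (isIntegral_quarticField_generator k)

/-! Since `5 + √5 = 2(φ + 2)` with `φ` the golden ratio, and factors 4 and 5 under the root can be
dropped (`√5` lies in the field), each `K_k` is `ℚ(β)` with `β² = s(w + 2)`, where `w` is the golden
ratio and `s` is square-free and prime to 5. The map `σ : β ↦ β(w - 1)` has order 4, so `K` is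
cyclic over `ℚ`, with quadratic subfield `ℚ(w) = ℚ(√5)`.

By `exists_relative_generator`, the ring of integers is `ℤ[w] ⊕ ℤ[w]ω` with `ω = (r(1 - w) + eβ)/2`,
where `e = r = 1` if `s ≡ 3` mod 4 and `e = 2`, `r = 0` otherwise. Then `discr_eq` gives `D^(1/2) =
5e²s√5`.

Lower bound (`le_integerMahlerMeasure`): a generator has `α - σ²α = γeβ` with `γ ≠ 0` in `ℤ[w]`. As
`β·σβ = s√5` and `|N(γ)| ≥ 1`, the product of `α - σ²α` and its image under `σ` is at least `e²s√5`
in size. It is also at most `4M(α)`, because `|x - y| ≤ 2 max(1,|x|) max(1,|y|)`. This yields the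
constant `1/20`, better than `1/1920`.

Upper bound (`exists_integerMahlerMeasure_le`): translate `ω` by an element of `ℤ[w]` that makes the
conjugates `σ²α` and `σ³α` bounded; the other two are then of size about `eβ` and `eσβ`, with
product `e²s√5`. Sharpness follows because `D` is unbounded along the family. -/

/-! ### Mahler measures of generators and Northcott finiteness -/

open Polynomial in
/-- Over a Galois extension, the minimal polynomial of a primitive element is the product of the
linear factors given by its conjugates. -/
theorem minpoly_map_eq_prod_conjugates {F K : Type*} [Field F] [Field K] [Algebra F K]
    [FiniteDimensional F K] [IsGalois F K] {α : K} (hα : IntermediateField.adjoin F {α} = ⊤) :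
    (minpoly F α).map (algebraMap F K) = ∏ τ : K ≃ₐ[F] K, (X - C (τ α)) := by
  have hint : IsIntegral F α := Algebra.IsIntegral.isIntegral α
  -- An automorphism is determined by its value at a generator, so the linear factors are pairwise
  -- coprime.
  have hinj : Function.Injective fun τ : K ≃ₐ[F] K => τ α := by
    intro τ₁ τ₂ h
    ext x
    have hx : x ∈ IntermediateField.adjoin F {α} := hα ▸ IntermediateField.mem_top
    induction hx using IntermediateField.adjoin_induction with
    | mem y hy => rw [Set.mem_singleton_iff.mp hy]; exact h
    | algebraMap y => simp
    | add y z _ _ hy hz => simp [hy, hz]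
    | inv y _ hy => simp [hy]
    | mul y z _ _ hy hz => simp [hy, hz]
  refine eq_of_monic_of_dvd_of_natDegree_le
    (monic_prod_of_monic _ (fun τ : K ≃ₐ[F] K => X - C (τ α)) fun τ _ => monic_X_sub_C _)
    ((minpoly.monic hint).map _) ?_ ?_
  · refine Finset.prod_dvd_of_coprime
      ((pairwise_coprime_X_sub_C hinj).set_pairwise _) fun τ _ => ?_
    rw [dvd_iff_isRoot, IsRoot.def, eval_map_algebraMap]
    exact (aeval_algHom_apply (τ : K →ₐ[F] K) α _).trans (by simp [minpoly.aeval])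
  · rw [natDegree_prod_of_monic _ _ fun τ _ => monic_X_sub_C _, natDegree_map]
    simp only [natDegree_X_sub_C, Finset.sum_const, Finset.card_univ, smul_eq_mul, mul_one]
    rw [← Nat.card_eq_fintype_card, IsGalois.card_aut_eq_finrank]
    exact minpoly.natDegree_le α

open Polynomial in
/-- In a Galois number field, the Mahler measure of an integral generator is a product over its
conjugates. -/
theorem integerMahlerMeasure_eq_prod {K : Type*} [Field K] [NumberField K] [IsGalois ℚ K]
    (ι : K →+* ℂ) {α : 𝓞 K} (hα : IntermediateField.adjoin ℚ {(α : K)} = ⊤) :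
    integerMahlerMeasure α = ∏ τ : K ≃ₐ[ℚ] K, max 1 ‖ι (τ α)‖ := by
  have h1 : (minpoly ℤ (α : K)).map (Int.castRingHom ℂ)
      = ∏ τ : K ≃ₐ[ℚ] K, (X - C (ι (τ α))) := by
    have h2 := congrArg (map ι) (minpoly_map_eq_prod_conjugates hα)
    rw [minpoly.isIntegrallyClosed_eq_field_fractions' ℚ
        (NumberField.RingOfIntegers.isIntegral_coe α),
      map_map, map_map, Polynomial.map_prod] at h2
    simp only [Polynomial.map_sub, map_X, map_C] at h2
    rw [← h2]
    congr 1
    exact RingHom.ext_int _ _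
  rw [integerMahlerMeasure, h1]
  rw [Finset.prod_eq_multiset_prod, Finset.prod_eq_multiset_prod,
    prod_mahlerMeasure_eq_mahlerMeasure_prod, Multiset.map_map]
  simp [mahlerMeasure_X_sub_C]

/-- Northcott: the minimal Mahler measure of an integral generator is attained. -/
theorem isLeast_minIntegralMahlerMeasure {K : Type*} [Field K] [NumberField K]
    (hne : (integralGeneratorMahlerMeasures K).Nonempty) :
    IsLeast (integralGeneratorMahlerMeasures K) (minIntegralMahlerMeasure K) := by
  obtain ⟨B, hB⟩ := hne
  have hB0 : 0 ≤ B := by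
    obtain ⟨α, _, rfl⟩ := hB
    exact Polynomial.mahlerMeasure_nonneg _
  have hfin : (integralGeneratorMahlerMeasures K ∩ Set.Iic B).Finite := by
    refine ((Polynomial.finite_mahlerMeasure_le (Module.finrank ℚ K) ⟨B, hB0⟩).image
      fun p => (p.map (Int.castRingHom ℂ)).mahlerMeasure).subset ?_
    rintro r ⟨⟨α, _, rfl⟩, hr⟩
    refine ⟨minpoly ℤ (α : K), ⟨?_, hr⟩, rfl⟩
    have h := minpoly.natDegree_le (A := ℚ) (α : K)
    rwa [minpoly.isIntegrallyClosed_eq_field_fractions' ℚ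
        (NumberField.RingOfIntegers.isIntegral_coe α),
      (minpoly.monic (NumberField.RingOfIntegers.isIntegral_coe α)).natDegree_map] at h
  have hne' : (integralGeneratorMahlerMeasures K ∩ Set.Iic B).Nonempty := ⟨B, hB, Set.self_mem_Iic⟩
  obtain ⟨m, hm, hmin⟩ := hfin.exists_minimal hne'
  have hleast : IsLeast (integralGeneratorMahlerMeasures K) m := by
    refine ⟨hm.1, fun r hr => ?_⟩
    rcases le_total m r with h | h
    · exact h
    · exact hmin ⟨hr, h.trans hm.2⟩ h
  have : minIntegralMahlerMeasure K = m := hleast.csInf_eq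
  rwa [this]

/-! ### Galois theory of the cyclic quartic field -/

/-- A number field `K` presented as `ℚ(β)` with `β² = s(w + 2)`, where `w` is the golden ratio,
together with an automorphism `σ` that sends `β` to `β(w - 1)` and a real embedding `ι`. -/
structure GoldenQuartic (K : Type*) [Field K] [NumberField K] (s : ℕ) where
  w : K
  β : K
  σ : K ≃ₐ[ℚ] K
  ι : K →+* ℝ
  w_sq : w ^ 2 = w + 1
  β_sq : β ^ 2 = s * (w + 2)
  σ_w : σ w = 1 - w
  σ_β : σ β = β * (w - 1)
  exists_coords : ∀ x : K, ∃ a b c d : ℚ, x = a + b * w + c * β + d * (w * β)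
  ι_w : ι w = Real.goldenRatio
  ι_β_pos : 0 < ι β
  finrank_eq : Module.finrank ℚ K = 4

namespace GoldenQuartic

variable {K : Type*} [Field K] [NumberField K] {s : ℕ}

theorem β_ne_zero (G : GoldenQuartic K s) : G.β ≠ 0 := by
  intro h
  have := G.ι_β_pos
  simp [h] at this

theorem σ_σ_w (G : GoldenQuartic K s) : G.σ (G.σ G.w) = G.w := by simp [G.σ_w]

theorem σ_σ_β (G : GoldenQuartic K s) : G.σ (G.σ G.β) = -G.β := by
  simp only [G.σ_w, G.σ_β, map_mul, map_sub, map_one]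
  linear_combination -G.β * G.w_sq

theorem σ_pow_four (G : GoldenQuartic K s) : G.σ ^ 4 = 1 := by
  ext x
  obtain ⟨a, b, c, d, rfl⟩ := G.exists_coords x
  simp only [pow_succ, pow_zero, one_mul, AlgEquiv.mul_apply, map_add, map_mul, map_ratCast,
    G.σ_σ_w, G.σ_σ_β, map_neg, neg_neg, AlgEquiv.one_apply]

theorem σ_sq_ne_one (G : GoldenQuartic K s) : G.σ ^ 2 ≠ 1 := by
  intro h
  have h1 : (G.σ ^ 2) G.β = G.β := by rw [h]; rfl
  rw [pow_two, AlgEquiv.mul_apply, G.σ_σ_β] at h1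
  exact G.β_ne_zero (self_eq_neg.mp h1.symm)

theorem orderOf_σ (G : GoldenQuartic K s) : orderOf G.σ = 4 := by
  have : Fact (Nat.Prime 2) := ⟨Nat.prime_two⟩
  exact orderOf_eq_prime_pow (p := 2) (n := 1) (by simpa using G.σ_sq_ne_one)
    (by simpa using G.σ_pow_four)

theorem card_gal (G : GoldenQuartic K s) : Nat.card (K ≃ₐ[ℚ] K) = 4 := by
  refine le_antisymm ?_ ?_
  · rw [← G.finrank_eq, Nat.card_eq_fintype_card]
    exact AlgEquiv.card_le
  · rw [← G.orderOf_σ]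
    exact orderOf_le_card

theorem isGalois (G : GoldenQuartic K s) : IsGalois ℚ K :=
  IsGalois.of_card_aut_eq_finrank ℚ K (by rw [G.card_gal, G.finrank_eq])

theorem isCyclic_gal (G : GoldenQuartic K s) : IsCyclic (K ≃ₐ[ℚ] K) :=
  isCyclic_of_orderOf_eq_card G.σ (by rw [G.orderOf_σ, G.card_gal])

open Classical in
theorem univ_gal (G : GoldenQuartic K s) :
    (Finset.univ : Finset (K ≃ₐ[ℚ] K)) = (Finset.range 4).image (G.σ ^ ·) := by
  symm
  rw [← Finset.card_eq_iff_eq_univ, Finset.card_image_of_injOn, Finset.card_range,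
    ← Nat.card_eq_fintype_card, G.card_gal]
  intro i hi j hj h
  rw [← G.orderOf_σ] at hi hj
  exact pow_injOn_Iio_orderOf (by simpa using hi) (by simpa using hj) h

theorem injOn_σ_pow (G : GoldenQuartic K s) : Set.InjOn (G.σ ^ ·) (Finset.range 4 : Set ℕ) := by
  intro i hi j hj h
  rw [← G.orderOf_σ] at hi hj
  exact pow_injOn_Iio_orderOf (by simpa using hi) (by simpa using hj) h

/-- The Galois group permutes the complex embeddings transitively, and `ι` is a real one. -/
theorem isTotallyReal (G : GoldenQuartic K s) : NumberField.IsTotallyReal K := by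
  have := G.isGalois
  refine ⟨fun v => ?_⟩
  obtain ⟨τ, hτ⟩ := NumberField.ComplexEmbedding.exists_comp_symm_eq_of_comp_eq (k := ℚ)
    (Complex.ofRealHom.comp G.ι) v.embedding (RingHom.ext fun q => by simp)
  rw [← NumberField.InfinitePlace.mk_embedding v, NumberField.InfinitePlace.isReal_mk_iff, ← hτ]
  ext x
  simp [NumberField.ComplexEmbedding.conjugate_coe_eq]

/-- An element generates `K` if and only if it is not fixed by the involution `σ²`. -/
theorem adjoin_eq_top_iff (G : GoldenQuartic K s) (α : K) :
    IntermediateField.adjoin ℚ {α} = ⊤ ↔ G.σ (G.σ α) ≠ α := by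
  have := G.isGalois
  constructor
  · intro h hα
    refine G.σ_sq_ne_one (AlgEquiv.ext fun x => ?_)
    have hx : x ∈ IntermediateField.adjoin ℚ {α} := h ▸ IntermediateField.mem_top
    rw [pow_two, AlgEquiv.mul_apply, AlgEquiv.one_apply]
    induction hx using IntermediateField.adjoin_induction with
    | mem y hy => rw [Set.mem_singleton_iff.mp hy, hα]
    | algebraMap y => simp
    | add y z _ _ hy hz => simp [hy, hz]
    | inv y _ hy => simp [hy]
    | mul y z _ _ hy hz => simp [hy, hz]
  · classical
    intro h
    rw [← IsGalois.fixedField_fixingSubgroup (IntermediateField.adjoin ℚ {α})]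
    -- Every nontrivial subgroup of a cyclic group of order 4 contains `σ²`.
    have hbot : (IntermediateField.adjoin ℚ {α}).fixingSubgroup = ⊥ := by
      rw [eq_bot_iff]
      intro τ hτ
      have hα : τ α = α := (IntermediateField.mem_fixingSubgroup_iff _ _).mp hτ α
        (IntermediateField.mem_adjoin_simple_self ℚ α)
      have hmem := Finset.mem_univ τ
      rw [G.univ_gal] at hmem
      obtain ⟨i, hi, rfl⟩ := Finset.mem_image.mp hmem
      have h4 : G.σ (G.σ (G.σ (G.σ α))) = α := by
        have := congrArg (fun f : K ≃ₐ[ℚ] K => f α) G.σ_pow_four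
        simpa [pow_succ] using this
      rw [Finset.mem_range] at hi
      interval_cases i
      · simp
      · simp only [pow_one] at hα
        exact absurd (by rw [hα, hα]) h
      · exact absurd (by simpa [pow_succ] using hα) h
      · simp only [pow_succ, pow_zero, one_mul, AlgEquiv.mul_apply] at hα
        rw [hα] at h4
        exact absurd (by rw [h4, h4]) h
    rw [hbot, IntermediateField.fixedField_bot]

theorem trace_eq (G : GoldenQuartic K s) (x : K) :
    algebraMap ℚ K (Algebra.trace ℚ K x) = x + G.σ x + G.σ (G.σ x) + G.σ (G.σ (G.σ x)) := by
  classical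
  have := G.isGalois
  rw [trace_eq_sum_automorphisms, G.univ_gal, Finset.sum_image G.injOn_σ_pow]
  simp [Finset.sum_range_succ]

theorem integerMahlerMeasure_eq (G : GoldenQuartic K s) {α : 𝓞 K}
    (hα : IntermediateField.adjoin ℚ {(α : K)} = ⊤) :
    integerMahlerMeasure α = max 1 |G.ι α| * max 1 |G.ι (G.σ α)| *
      max 1 |G.ι (G.σ (G.σ α))| * max 1 |G.ι (G.σ (G.σ (G.σ α)))| := by
  classical
  have := G.isGalois
  rw [integerMahlerMeasure_eq_prod (Complex.ofRealHom.comp G.ι) hα, G.univ_gal,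
    Finset.prod_image G.injOn_σ_pow]
  simp [Finset.prod_range_succ]

end GoldenQuartic

/-! ### Integrality and the ring of integers -/

/-- The square of the denominator of `q` is prime to that of the numerator, so it divides `s`. -/
theorem exists_int_eq_of_squarefree_mul_sq {s : ℕ} (hs : Squarefree s) {q : ℚ}
    (h : ∃ z : ℤ, (z : ℚ) = s * q ^ 2) : ∃ z : ℤ, (z : ℚ) = q := by
  obtain ⟨z, hz⟩ := h
  have hden : (q.den : ℚ) ≠ 0 := by exact_mod_cast q.den_nz
  have h1 : z * (q.den : ℤ) ^ 2 = s * q.num ^ 2 := by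
    have h2 : (z : ℚ) * q.den ^ 2 = s * (q.num : ℚ) ^ 2 := by
      rw [hz]
      conv_lhs => rw [← Rat.num_div_den q]
      simp only [Rat.num_div_den]
      rw [← Rat.mul_den_eq_num]
      ring
    exact_mod_cast h2
  have hcop : IsCoprime ((q.den : ℤ) ^ 2) (q.num ^ 2) :=
    (Int.isCoprime_iff_gcd_eq_one.mpr (by
      rw [Int.gcd_comm]; simpa [Int.gcd] using q.reduced)).pow
  have h3 : ((q.den * q.den : ℕ) : ℤ) ∣ s := by
    push_cast
    rw [← pow_two]
    exact hcop.dvd_of_dvd_mul_right (Dvd.intro_left z h1)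
  have h4 : q.den = 1 := Nat.isUnit_iff.mp (hs q.den (Int.natCast_dvd_natCast.mp h3))
  exact ⟨q.num, Rat.den_eq_one_iff _ |>.mp h4⟩

theorem exists_int_of_isIntegral_ratCast {K : Type*} [Field K] [CharZero K] {q : ℚ}
    (h : IsIntegral ℤ (q : K)) : ∃ z : ℤ, (z : ℚ) = q := by
  have h1 : IsIntegral ℤ q := by
    rw [← isIntegral_algebraMap_iff (B := K) (algebraMap ℚ K).injective]
    simpa using h
  obtain ⟨z, hz⟩ := IsIntegrallyClosed.isIntegral_iff.mp h1
  exact ⟨z, by simpa using hz⟩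

/-- Otherwise `T² - 5n²` is odd and 4 divides `s`. -/
theorem even_sub_of_mul_eq_four_mul {s T n M : ℤ} (hs : ¬ 4 ∣ s)
    (h : s * (T ^ 2 - 5 * n ^ 2) = 4 * M) : Even (T - n) := by
  by_contra hodd
  obtain ⟨j, hj⟩ := Int.not_even_iff_odd.mp hodd
  obtain rfl : T = n + (2 * j + 1) := by linarith
  have hcop : IsCoprime (4 : ℤ) ((n + (2 * j + 1)) ^ 2 - 5 * n ^ 2) := by
    have h2 : IsCoprime (2 : ℤ) ((n + (2 * j + 1)) ^ 2 - 5 * n ^ 2) :=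
      ⟨2 * n ^ 2 - 2 * j ^ 2 - 2 * n * j - n - 2 * j, 1, by ring⟩
    exact h2.pow_left (m := 2)
  exact hs (hcop.dvd_of_dvd_mul_right ⟨M, h⟩)

namespace GoldenQuartic

variable {K : Type*} [Field K] [NumberField K] {s : ℕ}

theorem isIntegral_w (G : GoldenQuartic K s) : IsIntegral ℤ G.w :=
  ⟨Polynomial.X ^ 2 - Polynomial.X - 1, by monicity!, by simp [G.w_sq]⟩

theorem isIntegral_β (G : GoldenQuartic K s) : IsIntegral ℤ G.β := by
  apply IsIntegral.of_pow (n := 2) (by norm_num)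
  rw [G.β_sq]
  have h2 : IsIntegral ℤ (2 : K) := by
    simpa using isIntegral_algebraMap (R := ℤ) (A := K) (x := 2)
  have hs : IsIntegral ℤ (s : K) := by
    simpa using isIntegral_algebraMap (R := ℤ) (A := K) (x := (s : ℤ))
  exact hs.mul (G.isIntegral_w.add h2)

theorem isIntegral_σ (G : GoldenQuartic K s) {x : K} (hx : IsIntegral ℤ x) :
    IsIntegral ℤ (G.σ x) := by
  simpa using hx.map (G.σ.toAlgHom.restrictScalars ℤ)

/-- The ring of integers of `ℚ(w)` is `ℤ[w]`. -/
theorem exists_int_of_isIntegral_add_mul_w (G : GoldenQuartic K s) {a b : ℚ}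
    (h : IsIntegral ℤ (a + b * G.w)) : (∃ m : ℤ, (m : ℚ) = a) ∧ ∃ n : ℤ, (n : ℚ) = b := by
  have hc := G.isIntegral_σ h
  rw [map_add, map_mul, map_ratCast, map_ratCast, G.σ_w] at hc
  have htr : IsIntegral ℤ ((2 * a + b : ℚ) : K) := by
    have e : ((2 * a + b : ℚ) : K) = (a + b * G.w) + (a + b * (1 - G.w)) := by push_cast; ring
    rw [e]
    exact h.add hc
  have hno : IsIntegral ℤ ((a ^ 2 + a * b - b ^ 2 : ℚ) : K) := by
    have e : ((a ^ 2 + a * b - b ^ 2 : ℚ) : K) = (a + b * G.w) * (a + b * (1 - G.w)) := by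
      push_cast
      linear_combination b ^ 2 * G.w_sq
    rw [e]
    exact h.mul hc
  obtain ⟨T, hT⟩ := exists_int_of_isIntegral_ratCast htr
  obtain ⟨N, hN⟩ := exists_int_of_isIntegral_ratCast hno
  -- With `T` the trace and `N` the norm, `T² - 4N = 5b²`.
  obtain ⟨n, hn⟩ := exists_int_eq_of_squarefree_mul_sq (s := 5) (q := b)
    Nat.prime_five.prime.squarefree ⟨T ^ 2 - 4 * N, by push_cast; rw [hT, hN]; ring⟩
  have h1 : 1 * (T ^ 2 - 5 * n ^ 2) = 4 * N := by
    have : (T : ℚ) ^ 2 - 5 * n ^ 2 = 4 * N := by rw [hT, hN, hn]; ring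
    rw [one_mul]
    exact_mod_cast this
  have h2 := even_sub_of_mul_eq_four_mul (by norm_num) h1
  obtain ⟨m, hm⟩ := h2
  refine ⟨⟨m, ?_⟩, n, hn⟩
  have : (T : ℚ) - n = m + m := by exact_mod_cast hm
  rw [hT, hn] at this
  linarith

/-- If `cβ` is an algebraic integer with `c ∈ ℚ(w)`, then `c ∈ ℤ[w]`. -/
theorem exists_int_of_isIntegral_mul_β (G : GoldenQuartic K s) (hs : Squarefree s)
    (h5 : Nat.Coprime 5 s) {a b : ℚ} (h : IsIntegral ℤ ((a + b * G.w) * G.β)) :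
    (∃ m : ℤ, (m : ℚ) = a) ∧ ∃ n : ℤ, (n : ℚ) = b := by
  have hc := G.isIntegral_σ h
  rw [map_mul, map_add, map_mul, map_ratCast, map_ratCast, G.σ_w, G.σ_β] at hc
  -- Put `c = a + bw`, with conjugate `c'`. Since `(w + 2)(w - 1) = 2w - 1 = √5`, this element is
  -- `s√5c²`, and its `w`-coordinate is `s(c² + c'²)`.
  have hsq : IsIntegral ℤ (((s * (2 * (2 * a * b + b ^ 2) - (a ^ 2 + b ^ 2)) : ℚ) : K) +
      ((s * (2 * (a ^ 2 + b ^ 2) + (2 * a * b + b ^ 2)) : ℚ) : K) * G.w) := by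
    have e : ((s * (2 * (2 * a * b + b ^ 2) - (a ^ 2 + b ^ 2)) : ℚ) : K) +
        ((s * (2 * (a ^ 2 + b ^ 2) + (2 * a * b + b ^ 2)) : ℚ) : K) * G.w =
        ((a + b * G.w) * G.β) * ((a + b * G.w) * G.β) * (G.w - 1) := by
      push_cast
      linear_combination (-(a + b * G.w) ^ 2 * (G.w - 1)) * G.β_sq -
        (s * (b ^ 2 * (G.w ^ 2 + 2 * G.w) + 2 * a * b * (G.w + 2) + a ^ 2 + b ^ 2)) * G.w_sq
    rw [e]
    exact (h.mul h).mul (G.isIntegral_w.sub isIntegral_one)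
  -- This is `s√5cc'`, whose constant coordinate is `-scc'`.
  have hno : IsIntegral ℤ (((-(s * (a ^ 2 + a * b - b ^ 2)) : ℚ) : K) +
      ((2 * (s * (a ^ 2 + a * b - b ^ 2)) : ℚ) : K) * G.w) := by
    have e : ((-(s * (a ^ 2 + a * b - b ^ 2)) : ℚ) : K) +
        ((2 * (s * (a ^ 2 + a * b - b ^ 2)) : ℚ) : K) * G.w =
        ((a + b * G.w) * G.β) * ((a + b * (1 - G.w)) * (G.β * (G.w - 1))) := by
      push_cast
      linear_combination (-(a + b * G.w) * (a + b * (1 - G.w)) * (G.w - 1)) * G.β_sq -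
        (s * (a ^ 2 + a * b + b ^ 2 * (1 - G.w - G.w ^ 2))) * G.w_sq
    rw [e]
    exact h.mul hc
  obtain ⟨v, hv⟩ := (G.exists_int_of_isIntegral_add_mul_w hsq).2
  obtain ⟨u, hu⟩ := (G.exists_int_of_isIntegral_add_mul_w hno).1
  -- `v - 2u = s(c + c')² = s(2a + b)²` and `v + 2u = s(c - c')² = 5sb²`; the latter needs `5s`
  -- square-free.
  obtain ⟨T, hT⟩ := exists_int_eq_of_squarefree_mul_sq hs (q := 2 * a + b)
    ⟨v - 2 * u, by push_cast; rw [hv, hu]; ring⟩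
  obtain ⟨n, hn⟩ := exists_int_eq_of_squarefree_mul_sq (s := 5 * s)
    ((Nat.squarefree_mul h5).mpr ⟨Nat.prime_five.prime.squarefree, hs⟩) (q := b)
    ⟨v + 2 * u, by push_cast; rw [hv, hu]; ring⟩
  have h4 : ¬ (4 : ℤ) ∣ s := fun hd => by
    have := Nat.isUnit_iff.mp (hs 2 (by exact_mod_cast hd))
    omega
  have h1 : (s : ℤ) * (T ^ 2 - 5 * n ^ 2) = 4 * -u := by
    have : (s : ℚ) * (T ^ 2 - 5 * n ^ 2) = 4 * -u := by rw [hT, hu, hn]; ring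
    exact_mod_cast this
  obtain ⟨m, hm⟩ := even_sub_of_mul_eq_four_mul h4 h1
  refine ⟨⟨m, ?_⟩, n, hn⟩
  have : (T : ℚ) - n = m + m := by exact_mod_cast hm
  rw [hT, hn] at this
  linarith

/-- Twice the coordinates of an algebraic integer are integers, subject to congruences
modulo 4. -/
theorem exists_int_two_mul_coords (G : GoldenQuartic K s) (hs : Squarefree s)
    (h5 : Nat.Coprime 5 s) {x : K} (hx : IsIntegral ℤ x) :
    ∃ a b c d : ℤ, 2 * x = a + b * G.w + c * G.β + d * (G.w * G.β) ∧
      (4 ∣ a ^ 2 + b ^ 2 - s * (2 * (c ^ 2 + d ^ 2) + (2 * c * d + d ^ 2))) ∧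
      (4 ∣ 2 * a * b + b ^ 2 - s * ((c ^ 2 + d ^ 2) + 3 * (2 * c * d + d ^ 2))) := by
  obtain ⟨a, b, c, d, rfl⟩ := G.exists_coords x
  have hc := G.isIntegral_σ (G.isIntegral_σ hx)
  simp only [map_add, map_mul, map_ratCast, G.σ_σ_w, G.σ_σ_β] at hc
  have hadd : IsIntegral ℤ (((2 * a : ℚ) : K) + ((2 * b : ℚ) : K) * G.w) := by
    refine cast (congrArg _ ?_) (hx.add hc)
    push_cast
    ring
  have hsub : IsIntegral ℤ ((((2 * c : ℚ) : K) + ((2 * d : ℚ) : K) * G.w) * G.β) := by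
    refine cast (congrArg _ ?_) (hx.sub hc)
    push_cast
    ring
  obtain ⟨⟨a₀, ha⟩, b₀, hb⟩ := G.exists_int_of_isIntegral_add_mul_w hadd
  obtain ⟨⟨c₀, hc₀⟩, d₀, hd⟩ := G.exists_int_of_isIntegral_mul_β hs h5 hsub
  -- The relative norm `x·σ²x = (a + bw)² - s(w + 2)(c + dw)²` lies in `ℤ[w]`; doubling the
  -- coordinates multiplies it by 4.
  have hnorm : IsIntegral ℤ
      (((a ^ 2 + b ^ 2 - s * (2 * (c ^ 2 + d ^ 2) + (2 * c * d + d ^ 2)) : ℚ) : K) +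
      ((2 * a * b + b ^ 2 - s * ((c ^ 2 + d ^ 2) + 3 * (2 * c * d + d ^ 2)) : ℚ) : K) * G.w) := by
    refine cast (congrArg _ ?_) (hx.mul hc)
    push_cast
    linear_combination (-(c + d * G.w) ^ 2) * G.β_sq +
      (b ^ 2 - s * (d ^ 2 * G.w + c * d * 2 + d ^ 2 * 3)) * G.w_sq
  obtain ⟨⟨u, hu⟩, v, hv⟩ := G.exists_int_of_isIntegral_add_mul_w hnorm
  obtain rfl : a = a₀ / 2 := by linarith
  obtain rfl : b = b₀ / 2 := by linarith
  obtain rfl : c = c₀ / 2 := by linarith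
  obtain rfl : d = d₀ / 2 := by linarith
  refine ⟨a₀, b₀, c₀, d₀, ?_, ⟨u, ?_⟩, v, ?_⟩
  · push_cast
    ring
  · rw [← Int.cast_inj (α := ℚ)]
    push_cast
    rw [hu]
    ring
  · rw [← Int.cast_inj (α := ℚ)]
    push_cast
    rw [hv]
    ring

end GoldenQuartic

/-- The hypotheses are the two coordinates of `(a + bw)² ≡ s(w + 2)(c + dw)²` mod 4, and `2 * a = 0`
in `ZMod 4` encodes that `a` is even. -/
theorem two_mul_eq_zero_of_norm_eq_zero : ∀ s a b c d : ZMod 4, s = 1 ∨ s = 2 →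
    a ^ 2 + b ^ 2 - s * (2 * (c ^ 2 + d ^ 2) + (2 * c * d + d ^ 2)) = 0 →
    2 * a * b + b ^ 2 - s * ((c ^ 2 + d ^ 2) + 3 * (2 * c * d + d ^ 2)) = 0 →
    2 * a = 0 ∧ 2 * b = 0 ∧ 2 * c = 0 ∧ 2 * d = 0 := by
  decide

/-- For `s ≡ 3` the same congruence forces only `a + bw ≡ (1 - w)(c + dw)` mod 2, because `3(w + 2)
≡ (1 - w)²` mod 4. -/
theorem two_mul_add_eq_zero_of_norm_eq_zero : ∀ a b c d : ZMod 4,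
    a ^ 2 + b ^ 2 - 3 * (2 * (c ^ 2 + d ^ 2) + (2 * c * d + d ^ 2)) = 0 →
    2 * a * b + b ^ 2 - 3 * ((c ^ 2 + d ^ 2) + 3 * (2 * c * d + d ^ 2)) = 0 →
    2 * (a - c + d) = 0 ∧ 2 * (b + c) = 0 := by
  decide

namespace GoldenQuartic

variable {K : Type*} [Field K] [NumberField K] {s : ℕ}

theorem isIntegral_half (G : GoldenQuartic K s) (h : s % 4 = 3) :
    IsIntegral ℤ ((1 - G.w + G.β) / 2) := by
  obtain ⟨t, rfl⟩ : ∃ t, s = 4 * t + 3 := ⟨s / 4, by omega⟩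
  set y := (1 - G.w + G.β) / 2 with hy
  have hβ : G.β = 2 * y - (1 - G.w) := by rw [hy]; ring
  have hβ2 := G.β_sq
  rw [hβ] at hβ2
  push_cast at hβ2
  have hquad : y ^ 2 - (1 - G.w) * y - ((1 + 2 * t) + (t + 1) * G.w) = 0 := by
    linear_combination (1 / 4) * hβ2 - (1 / 4) * G.w_sq
  -- This quartic is the product of the quadratic in `hquad` and its conjugate under `w ↦ 1 - w`.
  refine ⟨Polynomial.X ^ 4 - Polynomial.X ^ 3 - Polynomial.C (4 + 5 * t : ℤ) * Polynomial.X ^ 2 +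
    Polynomial.C (4 + 5 * t : ℤ) * Polynomial.X + Polynomial.C (5 * t ^ 2 + 5 * t + 1 : ℤ),
    by monicity!, ?_⟩
  simp only [Polynomial.eval₂_add, Polynomial.eval₂_sub, Polynomial.eval₂_mul,
    Polynomial.eval₂_pow, Polynomial.eval₂_X, Polynomial.eval₂_C]
  push_cast [algebraMap_int_eq, eq_intCast]
  linear_combination (y ^ 2 - G.w * y - ((2 + 3 * t) - (t + 1) * G.w)) * hquad +
    ((t + 1) ^ 2 + y ^ 2 - (2 * t + 2) * y) * G.w_sq

/-- The ring of integers of `K` is free over `ℤ[w]` with basis `1` and `β` or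
`(1 - w + β) / 2`. -/
theorem exists_relative_generator (G : GoldenQuartic K s) (hs : Squarefree s)
    (h5 : Nat.Coprime 5 s) :
    ∃ (e : ℕ) (r : ℤ), ((e = 1 ∧ r = 1 ∧ 3 ≤ s) ∨ (e = 2 ∧ r = 0)) ∧
      IsIntegral ℤ ((r * (1 - G.w) + e * G.β) / 2) ∧
      ∀ x : K, IsIntegral ℤ x → ∃ m n p q : ℤ,
        x = m + n * G.w + (p + q * G.w) * ((r * (1 - G.w) + e * G.β) / 2) := by
  have h4 : s % 4 ≠ 0 := fun h => by
    have := Nat.isUnit_iff.mp (hs 2 (by omega))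
    omega
  have hcast (z : ℤ) : (z : ZMod 4) = 0 ↔ 4 ∣ z := ZMod.intCast_zmod_eq_zero_iff_dvd z 4
  by_cases h3 : s % 4 = 3
  · refine ⟨1, 1, .inl ⟨rfl, rfl, by omega⟩, by simpa using G.isIntegral_half h3, fun x hx => ?_⟩
    obtain ⟨a, b, c, d, h, h1, h2⟩ := G.exists_int_two_mul_coords hs h5 hx
    have hs3 : (s : ZMod 4) = 3 := by
      rw [← ZMod.natCast_mod, h3]; rfl
    rw [← hcast] at h1 h2
    push_cast [hs3] at h1 h2
    obtain ⟨k1, k2⟩ := two_mul_add_eq_zero_of_norm_eq_zero _ _ _ _ h1 h2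
    obtain ⟨m, hm⟩ := (hcast (2 * (a - c + d))).mp (by exact_mod_cast k1)
    obtain ⟨n, hn⟩ := (hcast (2 * (b + c))).mp (by exact_mod_cast k2)
    obtain rfl : a = 2 * m + c - d := by linarith
    obtain rfl : b = 2 * n - c := by linarith
    refine ⟨m, n, c, d, ?_⟩
    push_cast at h ⊢
    linear_combination h / 2 + d / 2 * G.w_sq
  · refine ⟨2, 0, .inr ⟨rfl, rfl⟩, by simpa using G.isIntegral_β, fun x hx => ?_⟩
    obtain ⟨a, b, c, d, h, h1, h2⟩ := G.exists_int_two_mul_coords hs h5 hx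
    have hs12 : (s : ZMod 4) = 1 ∨ (s : ZMod 4) = 2 := by
      rw [← ZMod.natCast_mod]
      obtain h | h : s % 4 = 1 ∨ s % 4 = 2 := by omega
      · left; rw [h]; rfl
      · right; rw [h]; rfl
    rw [← hcast] at h1 h2
    push_cast at h1 h2
    obtain ⟨k1, k2, k3, k4⟩ := two_mul_eq_zero_of_norm_eq_zero _ _ _ _ _ hs12 h1 h2
    obtain ⟨a', ha⟩ := (hcast (2 * a)).mp (by exact_mod_cast k1)
    obtain ⟨b', hb⟩ := (hcast (2 * b)).mp (by exact_mod_cast k2)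
    obtain ⟨c', hc⟩ := (hcast (2 * c)).mp (by exact_mod_cast k3)
    obtain ⟨d', hd⟩ := (hcast (2 * d)).mp (by exact_mod_cast k4)
    obtain rfl : a = 2 * a' := by linarith
    obtain rfl : b = 2 * b' := by linarith
    obtain rfl : c = 2 * c' := by linarith
    obtain rfl : d = 2 * d' := by linarith
    refine ⟨a', b', c', d', ?_⟩
    push_cast at h ⊢
    linear_combination h / 2

/-! ### The discriminant -/

theorem trace_coords (G : GoldenQuartic K s) {x : K} (a b c d : ℚ)
    (hx : x = a + b * G.w + c * G.β + d * (G.w * G.β)) :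
    Algebra.trace ℚ K x = 4 * a + 2 * b := by
  have h : x + G.σ (G.σ x) = 2 * a + 2 * b * G.w := by
    simp only [hx, map_add, map_mul, map_ratCast, G.σ_σ_w, G.σ_σ_β]
    ring
  have h' : G.σ x + G.σ (G.σ (G.σ x)) = 2 * a + 2 * b * (1 - G.w) := by
    rw [← map_add, h, map_add, map_mul, map_mul, map_mul, map_ratCast, map_ratCast, G.σ_w,
      map_ofNat]
  apply (algebraMap ℚ K).injective
  rw [G.trace_eq, eq_ratCast]
  push_cast
  linear_combination h + h'

/-- The value agrees with the tower formula: `ω` has relative discriminant `e²s(w + 2)`, of norm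
`5e⁴s²`, and `ℚ(√5)` contributes `5²`. The proof evaluates the trace matrix on `1, w, ω, wω`. -/
theorem discr_eq (G : GoldenQuartic K s) {e : ℕ} {r : ℤ}
    (hint : IsIntegral ℤ ((r * (1 - G.w) + e * G.β) / 2))
    (hspan : ∀ x : K, IsIntegral ℤ x → ∃ m n p q : ℤ,
        x = m + n * G.w + (p + q * G.w) * ((r * (1 - G.w) + e * G.β) / 2)) :
    NumberField.discr K = 125 * ((e : ℤ) ^ 2 * s) ^ 2 := by
  let ω : 𝓞 K := ⟨_, hint⟩
  let w : 𝓞 K := ⟨G.w, G.isIntegral_w⟩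
  let v : Fin 4 → 𝓞 K := ![1, w, ω, w * ω]
  have h0 : (v 0 : K) = 1 := rfl
  have h1 : (v 1 : K) = G.w := rfl
  have h2 : (v 2 : K) = (r * (1 - G.w) + e * G.β) / 2 := rfl
  have h3 : (v 3 : K) = G.w * ((r * (1 - G.w) + e * G.β) / 2) := rfl
  have htop : ⊤ ≤ Submodule.span ℤ (Set.range v) := by
    rintro x -
    obtain ⟨m, n, p, q, h⟩ := hspan x x.isIntegral_coe
    rw [Submodule.mem_span_range_iff_exists_fun]
    refine ⟨![m, n, p, q], ?_⟩
    apply NumberField.RingOfIntegers.ext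
    simp only [Fin.sum_univ_four, map_add, zsmul_eq_mul, map_mul, map_intCast, h0, h1, h2, h3,
      Matrix.cons_val]
    rw [h]
    ring
  have hcard : Fintype.card (Fin 4) = Module.finrank ℤ (𝓞 K) := by
    rw [NumberField.RingOfIntegers.rank, G.finrank_eq, Fintype.card_fin]
  let B := basisOfTopLeSpanOfCardEqFinrank v htop hcard
  rw [← NumberField.discr_eq_discr K B, coe_basisOfTopLeSpanOfCardEqFinrank, Algebra.discr_def,
    ← Int.cast_inj (α := ℚ), Int.cast_det]
  have hentry (i j : Fin 4) (a b c d : ℚ)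
      (h : ((v i : K) * v j) = a + b * G.w + c * G.β + d * (G.w * G.β)) :
      ((Algebra.trace ℤ (𝓞 K) (v i * v j) : ℤ) : ℚ) = 4 * a + 2 * b := by
    rw [Algebra.coe_trace_int]
    exact G.trace_coords a b c d h
  have hsymm (i j : Fin 4) : Algebra.trace ℤ (𝓞 K) (v i * v j) =
      Algebra.trace ℤ (𝓞 K) (v j * v i) := by rw [mul_comm]
  have hM : (Algebra.traceMatrix ℤ v).map (fun z : ℤ => (z : ℚ)) =
      !![4, 2, (r : ℚ), -2 * r;
         2, 6, -2 * r, -r;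
         r, -2 * r, (3 * r ^ 2 + 5 * e ^ 2 * s) / 2, (-r ^ 2 + 5 * e ^ 2 * s) / 2;
         -2 * r, -r, (-r ^ 2 + 5 * e ^ 2 * s) / 2, r ^ 2 + 5 * e ^ 2 * s] := by
    have e00 := hentry 0 0 1 0 0 0 (by rw [h0]; push_cast; ring)
    have e01 := hentry 0 1 0 1 0 0 (by rw [h0, h1]; push_cast; ring)
    have e02 := hentry 0 2 (r / 2) (-r / 2) (e / 2) 0 (by rw [h0, h2]; push_cast; ring)
    have e03 := hentry 0 3 (-r / 2) 0 0 (e / 2) (by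
      rw [h0, h3]; push_cast; linear_combination (-r / 2) * G.w_sq)
    have e11 := hentry 1 1 1 1 0 0 (by rw [h1]; push_cast; linear_combination G.w_sq)
    have e12 := hentry 1 2 (-r / 2) 0 0 (e / 2) (by
      rw [h1, h2]; push_cast; linear_combination (-r / 2) * G.w_sq)
    have e13 := hentry 1 3 0 (-r / 2) (e / 2) (e / 2) (by
      rw [h1, h3]; push_cast; linear_combination (-r / 2 * G.w + e / 2 * G.β) * G.w_sq)
    have e22 := hentry 2 2 (r ^ 2 / 2 + e ^ 2 * s / 2) (-r ^ 2 / 4 + e ^ 2 * s / 4) (r * e / 2)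
      (-r * e / 2) (by
      rw [h2]; push_cast
      linear_combination (r ^ 2 / 4) * G.w_sq + (e ^ 2 / 4) * G.β_sq)
    have e23 := hentry 2 3 (-r ^ 2 / 4 + e ^ 2 * s / 4) (r ^ 2 / 4 + 3 * e ^ 2 * s / 4)
      (-r * e / 2) 0 (by
      rw [h2, h3]; push_cast
      linear_combination (r ^ 2 / 4 * (G.w - 1) - r * e / 2 * G.β + e ^ 2 * s / 4) * G.w_sq +
        (e ^ 2 / 4 * G.w) * G.β_sq)
    have e33 := hentry 3 3 (r ^ 2 / 4 + 3 * e ^ 2 * s / 4) (e ^ 2 * s)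
      0 (-r * e / 2) (by
      rw [h3]; push_cast
      linear_combination (r ^ 2 / 4 * (G.w ^ 2 - G.w + 1) - r * e / 2 * G.β * G.w +
        e ^ 2 * s / 4 * (G.w + 3)) * G.w_sq + (e ^ 2 / 4 * G.w ^ 2) * G.β_sq)
    ext i j
    fin_cases i <;> fin_cases j <;>
      simp only [Matrix.map_apply, Algebra.traceMatrix_apply, Algebra.traceForm_apply,
        Fin.zero_eta, Fin.mk_one, Fin.reduceFinMk, hsymm 1 0, hsymm 2 0, hsymm 3 0, hsymm 2 1,
        hsymm 3 1, hsymm 3 2, e00, e01, e02, e03, e11, e12, e13, e22, e23, e33, Matrix.of_apply,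
        Matrix.cons_val', Matrix.cons_val] <;> ring
  rw [show (Algebra.traceMatrix ℤ v).map (Int.cast : ℤ → ℚ) = _ from hM, Matrix.det_succ_row_zero]
  simp [Fin.sum_univ_succ, Matrix.det_fin_three, Matrix.submatrix, Fin.succAbove]
  ring

end GoldenQuartic

/-! ### Lower and upper bounds for the Mahler measure -/

open Real in
/-- Every point of the plane is close to the lattice `{(x, x')}` of algebraic integers `x` of
`ℚ(√5)`. -/
theorem exists_int_golden_approx (u v : ℝ) : ∃ m n : ℤ,
    |m + n * goldenRatio + u| ≤ 9 / 8 ∧ |m + n * (1 - goldenRatio) + v| ≤ 9 / 8 := by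
  have hφ := goldenRatio_sq
  have hφ1 := one_lt_goldenRatio
  have hφ2 : goldenRatio ≤ 13 / 8 := by nlinarith
  set φ := goldenRatio
  have hd : 0 < 2 * φ - 1 := by linarith
  -- Rounding makes the difference of the two coordinates at most `√5/2`, then their sum at most 1;
  -- each coordinate is at most `(1 + √5/2)/2 < 9/8`.
  obtain ⟨n, hn⟩ : ∃ n : ℤ, |n * (2 * φ - 1) + (u - v)| ≤ (2 * φ - 1) / 2 := by
    refine ⟨round ((v - u) / (2 * φ - 1)), ?_⟩
    have h := abs_sub_round ((v - u) / (2 * φ - 1))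
    have e : round ((v - u) / (2 * φ - 1)) * (2 * φ - 1) + (u - v) =
        -((2 * φ - 1) * ((v - u) / (2 * φ - 1) - round ((v - u) / (2 * φ - 1)))) := by
      field_simp
      ring
    rw [e, abs_neg, abs_mul, abs_of_pos hd]
    nlinarith
  obtain ⟨m, hm⟩ : ∃ m : ℤ, |2 * m + (n + u + v)| ≤ 1 := by
    refine ⟨round (-(n + u + v) / 2), ?_⟩
    have h := abs_sub_round (-(n + u + v) / 2)
    rw [abs_le] at h ⊢
    constructor <;> linarith
  refine ⟨m, n, ?_⟩
  simp only [abs_le] at *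
  constructor <;> constructor <;> linarith

theorem abs_sub_le_two_mul_max (x y : ℝ) : |x - y| ≤ 2 * (max 1 |x| * max 1 |y|) := by
  have hx := le_max_left 1 |x|
  have hx' := le_max_right 1 |x|
  have hy := le_max_left 1 |y|
  have hy' := le_max_right 1 |y|
  have := abs_sub x y
  nlinarith

namespace GoldenQuartic

variable {K : Type*} [Field K] [NumberField K] {s : ℕ}

theorem ι_σ_w (G : GoldenQuartic K s) : G.ι (G.σ G.w) = 1 - Real.goldenRatio := by
  rw [G.σ_w, map_sub, map_one, G.ι_w]

theorem ι_σ_β (G : GoldenQuartic K s) : G.ι (G.σ G.β) = G.ι G.β * (Real.goldenRatio - 1) := by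
  rw [G.σ_β, map_mul, map_sub, map_one, G.ι_w]

theorem ι_β_sq (G : GoldenQuartic K s) : G.ι G.β ^ 2 = s * (Real.goldenRatio + 2) := by
  rw [← map_pow, G.β_sq, map_mul, map_add, G.ι_w, map_natCast, map_ofNat]

/-- The product of the differences of the conjugates of a generator over `ℚ(√5)` is at least
that of `eβ`. -/
theorem le_integerMahlerMeasure (G : GoldenQuartic K s) {e : ℕ} {r : ℤ}
    (hspan : ∀ x : K, IsIntegral ℤ x → ∃ m n p q : ℤ,
        x = m + n * G.w + (p + q * G.w) * ((r * (1 - G.w) + e * G.β) / 2))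
    {α : 𝓞 K} (hα : IntermediateField.adjoin ℚ {(α : K)} = ⊤) :
    (e : ℝ) ^ 2 * s * (2 * Real.goldenRatio - 1) / 4 ≤ integerMahlerMeasure α := by
  rw [G.integerMahlerMeasure_eq hα]
  rw [G.adjoin_eq_top_iff] at hα
  obtain ⟨m, n, p, q, h⟩ := hspan α α.isIntegral_coe
  generalize (α : K) = x at *
  have hφ := Real.goldenRatio_sq
  have hφ1 := Real.one_lt_goldenRatio
  have hιβ := G.ι_β_sq
  have hδ : x - G.σ (G.σ x) = (p + q * G.w) * (e * G.β) := by
    rw [h]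
    simp only [map_add, map_mul, map_intCast, map_div₀, map_sub, map_one, map_natCast, map_ofNat,
      G.σ_σ_w, G.σ_σ_β]
    ring
  -- This is the norm of `p + qw`, which is nonzero because `σ²` moves a generator.
  have hN : p ^ 2 + p * q - q ^ 2 ≠ 0 := by
    intro h0
    have h1 : (p + q * G.w) * G.σ (p + q * G.w) = 0 := by
      rw [map_add, map_mul, map_intCast, map_intCast, G.σ_w]
      have : (p : K) ^ 2 + p * q - q ^ 2 = 0 := by exact_mod_cast h0
      linear_combination this - q ^ 2 * G.w_sq
    have h2 : (p + q * G.w : K) = 0 := by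
      rcases mul_eq_zero.mp h1 with h2 | h2
      · exact h2
      · exact (map_eq_zero G.σ).mp h2
    rw [h2, zero_mul, sub_eq_zero] at hδ
    exact hα hδ.symm
  have hN1 : (1 : ℝ) ≤ |(p : ℝ) ^ 2 + p * q - q ^ 2| := by
    exact_mod_cast Int.one_le_abs hN
  have hprod : (G.ι x - G.ι (G.σ (G.σ x))) * (G.ι (G.σ x) - G.ι (G.σ (G.σ (G.σ x)))) =
      ((p : ℝ) ^ 2 + p * q - q ^ 2) * (e ^ 2 * s * (2 * Real.goldenRatio - 1)) := by
    rw [← map_sub, ← map_sub, ← map_sub G.σ, hδ]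
    simp only [map_mul, map_add, map_intCast, map_natCast, G.ι_w, G.ι_σ_w, G.ι_σ_β]
    set φ := Real.goldenRatio
    linear_combination ((p + q * φ) * (p + q * (1 - φ)) * e ^ 2 * (φ - 1)) * hιβ +
      (e ^ 2 * s * ((p + q * φ) * (p + q * (1 - φ)) - q ^ 2 * (2 * φ - 1))) * hφ
  have h1 := abs_sub_le_two_mul_max (G.ι x) (G.ι (G.σ (G.σ x)))
  have h2 := abs_sub_le_two_mul_max (G.ι (G.σ x)) (G.ι (G.σ (G.σ (G.σ x))))
  have h3 := mul_le_mul h1 h2 (abs_nonneg _) (by positivity)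
  rw [← abs_mul, hprod, abs_mul] at h3
  have h4 : 0 ≤ (e : ℝ) ^ 2 * s * (2 * Real.goldenRatio - 1) :=
    mul_nonneg (by positivity) (by linarith)
  rw [abs_of_nonneg h4] at h3
  have h5 := mul_le_mul_of_nonneg_right hN1 h4
  linarith

theorem exists_integerMahlerMeasure_le (G : GoldenQuartic K s) {e : ℕ} {r : ℤ}
    (he : 3 ≤ e ^ 2 * s)
    (hint : IsIntegral ℤ ((r * (1 - G.w) + e * G.β) / 2)) :
    ∃ α : 𝓞 K, IntermediateField.adjoin ℚ {(α : K)} = ⊤ ∧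
      integerMahlerMeasure α ≤ 5 * (e ^ 2 * s * (2 * Real.goldenRatio - 1)) := by
  set φ := Real.goldenRatio with hφdef
  have hφ : φ ^ 2 = φ + 1 := Real.goldenRatio_sq
  have hφ1 : 1 < φ := Real.one_lt_goldenRatio
  have hφ2 : φ ≤ 13 / 8 := by nlinarith
  set b := G.ι G.β with hb
  have hb0 : 0 < b := G.ι_β_pos
  have hb2 : b ^ 2 = s * (φ + 2) := G.ι_β_sq
  have he' : (3 : ℝ) ≤ e ^ 2 * s := by exact_mod_cast he
  -- The square is `e²s(3 - φ) ≥ 3(3 - 13/8) > 4`.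
  have hγ' : 2 ≤ e * (b * (φ - 1)) := by
    have h0 : 0 ≤ e * (b * (φ - 1)) :=
      mul_nonneg (by positivity) (mul_nonneg hb0.le (by linarith))
    have h1 : (e * (b * (φ - 1))) ^ 2 = e ^ 2 * s * (3 - φ) := by
      linear_combination (e ^ 2 * (φ - 1) ^ 2) * hb2 + (e ^ 2 * s * (φ + 1)) * hφ
    nlinarith
  have hγ : 2 ≤ e * b := by
    have h0 : 0 ≤ e * b := by positivity
    nlinarith
  -- The two targets are the real images of `σ²ω` and `σ³ω`.
  obtain ⟨m, n, hx, hy⟩ := exists_int_golden_approx ((r * (1 - φ) - e * b) / 2)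
    ((r * φ - e * (b * (φ - 1))) / 2)
  rw [← hφdef] at hx hy
  have hintα : IsIntegral ℤ (m + n * G.w + (r * (1 - G.w) + e * G.β) / 2) :=
    ((isIntegral_algebraMap (R := ℤ) (x := m)).add
      ((isIntegral_algebraMap (R := ℤ) (x := n)).mul G.isIntegral_w)).add hint
  have hσ2 : G.σ (G.σ (m + n * G.w + (r * (1 - G.w) + e * G.β) / 2)) =
      m + n * G.w + (r * (1 - G.w) - e * G.β) / 2 := by
    simp only [map_add, map_mul, map_intCast, map_div₀, map_sub, map_one, map_natCast, map_ofNat,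
      G.σ_σ_w, G.σ_σ_β]
    ring
  have hgen : IntermediateField.adjoin ℚ {m + n * G.w + (r * (1 - G.w) + e * G.β) / 2} = ⊤ := by
    rw [G.adjoin_eq_top_iff, hσ2]
    intro h
    have h1 : (e : K) * G.β = 0 := by linear_combination -h
    have h2 := congrArg G.ι h1
    rw [map_mul, map_natCast, map_zero, ← hb] at h2
    linarith
  obtain ⟨α, hα⟩ : ∃ α : 𝓞 K, (α : K) = m + n * G.w + (r * (1 - G.w) + e * G.β) / 2 :=
    ⟨⟨_, hintα⟩, rfl⟩
  rw [← hα] at hgen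
  refine ⟨α, hgen, ?_⟩
  rw [G.integerMahlerMeasure_eq hgen, hα, hσ2]
  simp only [map_add, map_mul, map_intCast, map_div₀, map_sub, map_one, map_natCast, map_ofNat,
    G.ι_w, G.ι_σ_w, G.ι_σ_β, ← hb, ← hφdef, sub_sub_cancel]
  set X := m + n * φ + (r * (1 - φ) - e * b) / 2 with hX
  set Y := m + n * (1 - φ) + (r * φ - e * (b * (φ - 1))) / 2 with hY
  have e1 : m + n * φ + (r * (1 - φ) + e * b) / 2 = X + e * b := by rw [hX]; ring
  have e2 : m + n * (1 - φ) + (r * φ + e * (b * (φ - 1))) / 2 = Y + e * (b * (φ - 1)) := by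
    rw [hY]; ring
  rw [e1, e2]
  -- Since `eb ≥ 2`, the error `9/8` is at most `(9/16)eb`.
  have k1 : max 1 |X + e * b| ≤ 25 / 16 * (e * b) := by
    rw [abs_le] at hx
    refine max_le (by linarith) (abs_le.mpr ⟨by linarith, by linarith⟩)
  have k2 : max 1 |Y + e * (b * (φ - 1))| ≤ 25 / 16 * (e * (b * (φ - 1))) := by
    rw [abs_le] at hy
    refine max_le (by linarith) (abs_le.mpr ⟨by linarith, by linarith⟩)
  have k3 : max 1 |X| ≤ 9 / 8 := max_le (by norm_num) hx
  have k4 : max 1 |Y| ≤ 9 / 8 := max_le (by norm_num) hy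
  calc _ ≤ 25 / 16 * (e * b) * (25 / 16 * (e * (b * (φ - 1)))) * (9 / 8) * (9 / 8) := by
        gcongr
    _ = (25 / 16) ^ 2 * (9 / 8) ^ 2 * (e ^ 2 * s * (2 * φ - 1)) := by
        linear_combination ((25 / 16) ^ 2 * (9 / 8) ^ 2 * e ^ 2 * (φ - 1)) * hb2 +
          ((25 / 16) ^ 2 * (9 / 8) ^ 2 * e ^ 2 * s) * hφ
    _ ≤ 5 * (e ^ 2 * s * (2 * φ - 1)) := by
        have : 0 ≤ (e : ℝ) ^ 2 * s * (2 * φ - 1) := mul_nonneg (by positivity) (by linarith)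
        linarith

theorem absDiscr_eq (G : GoldenQuartic K s) {e : ℕ} {r : ℤ}
    (hint : IsIntegral ℤ ((r * (1 - G.w) + e * G.β) / 2))
    (hspan : ∀ x : K, IsIntegral ℤ x → ∃ m n p q : ℤ,
        x = m + n * G.w + (p + q * G.w) * ((r * (1 - G.w) + e * G.β) / 2)) :
    absDiscr K = (5 * (e ^ 2 * s * (2 * Real.goldenRatio - 1))) ^ 2 := by
  rw [absDiscr, G.discr_eq hint hspan, abs_of_nonneg (by positivity)]
  push_cast
  linear_combination (-100 * (e ^ 2 * s : ℝ) ^ 2) * Real.goldenRatio_sq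

theorem minIntegralMahlerMeasure_bounds (G : GoldenQuartic K s) (hs : Squarefree s)
    (h5 : Nat.Coprime 5 s) :
    IsLeast (integralGeneratorMahlerMeasures K) (minIntegralMahlerMeasure K) ∧
      (1 / 20 : ℝ) * absDiscr K ^ (1 / 2 : ℝ) ≤ minIntegralMahlerMeasure K ∧
      minIntegralMahlerMeasure K ≤ absDiscr K ^ (1 / 2 : ℝ) ∧
      (125 : ℝ) * s ^ 2 ≤ absDiscr K := by
  obtain ⟨e, r, her, hint, hspan⟩ := G.exists_relative_generator hs h5
  have hs0 : 0 < s := Nat.pos_of_ne_zero hs.ne_zero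
  have he : 3 ≤ e ^ 2 * s := by
    rcases her with ⟨rfl, -, h⟩ | ⟨rfl, -⟩ <;> omega
  have he1 : 1 ≤ e := by
    rcases her with ⟨rfl, -, h⟩ | ⟨rfl, -⟩ <;> norm_num
  obtain ⟨α, hα, hle⟩ := G.exists_integerMahlerMeasure_le he hint
  have hleast := isLeast_minIntegralMahlerMeasure ⟨_, α, hα, rfl⟩
  have hD := G.absDiscr_eq hint hspan
  have hφ1 := Real.one_lt_goldenRatio
  have hsqrt : absDiscr K ^ (1 / 2 : ℝ) = 5 * (e ^ 2 * s * (2 * Real.goldenRatio - 1)) := by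
    rw [← Real.sqrt_eq_rpow, hD, Real.sqrt_sq]
    exact mul_nonneg (by norm_num) (mul_nonneg (by positivity) (by linarith))
  refine ⟨hleast, ?_, ?_, ?_⟩
  · obtain ⟨α', hα', h⟩ := hleast.1
    rw [h, hsqrt]
    have := G.le_integerMahlerMeasure hspan hα'
    linarith
  · rw [hsqrt]
    exact (hleast.2 ⟨α, hα, rfl⟩).trans hle
  · have h1 : (1 : ℝ) ≤ e ^ 4 := one_le_pow₀ (by exact_mod_cast he1)
    have h2 : absDiscr K = 125 * s ^ 2 * e ^ 4 := by
      rw [hD]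
      linear_combination (100 * (e ^ 2 * s : ℝ) ^ 2) * Real.goldenRatio_sq
    rw [h2]
    exact le_mul_of_one_le_right (by positivity) h1

end GoldenQuartic

/-! ### Realising the fields inside the real numbers -/

section

open IntermediateField Polynomial

/-- The real number `√(s(φ + 2))`, where `φ` is the golden ratio. -/
noncomputable def goldenSqrt (s : ℕ) : ℝ := √(s * (Real.goldenRatio + 2))

theorem goldenSqrt_sq (s : ℕ) : goldenSqrt s ^ 2 = s * (Real.goldenRatio + 2) := by
  have := Real.goldenRatio_pos
  rw [goldenSqrt, Real.sq_sqrt (by positivity)]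

theorem goldenSqrt_pos {s : ℕ} (hs : 0 < s) : 0 < goldenSqrt s := by
  have := Real.goldenRatio_pos
  have : (0 : ℝ) < s := by exact_mod_cast hs
  rw [goldenSqrt]
  positivity

/-- The polynomial `X⁴ - 5sX² + 5s²`, which has `√(s(φ + 2))` as a root. -/
noncomputable def goldenPoly (s : ℕ) : ℤ[X] :=
  X ^ 4 - C (5 * s : ℤ) * X ^ 2 + C (5 * s ^ 2 : ℤ)

theorem monic_goldenPoly (s : ℕ) : (goldenPoly s).Monic := by
  rw [goldenPoly]
  monicity!

theorem natDegree_goldenPoly (s : ℕ) : (goldenPoly s).natDegree = 4 := by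
  rw [goldenPoly]
  compute_degree!

/-- Eisenstein at 5: the constant term `5s²` is not divisible by 25 because 5 does not divide `s`.
-/
theorem irreducible_goldenPoly {s : ℕ} (h5 : Nat.Coprime 5 s) : Irreducible (goldenPoly s) := by
  have hprime : Prime (5 : ℤ) := Int.prime_iff_natAbs_prime.mpr Nat.prime_five
  refine IsEisensteinAt.irreducible (𝓟 := Ideal.span {(5 : ℤ)}) ⟨?_, ?_, ?_⟩
    ((Ideal.span_singleton_prime (by norm_num)).mpr hprime) (monic_goldenPoly s).isPrimitive
    (by rw [natDegree_goldenPoly]; norm_num)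
  · rw [(monic_goldenPoly s).leadingCoeff, Ideal.mem_span_singleton]
    norm_num
  · intro n hn
    rw [natDegree_goldenPoly] at hn
    rw [Ideal.mem_span_singleton, goldenPoly, coeff_add, coeff_sub, coeff_X_pow, coeff_C_mul,
      coeff_X_pow, coeff_C]
    interval_cases n <;> norm_num
  · rw [Ideal.span_singleton_pow, Ideal.mem_span_singleton, goldenPoly]
    intro h
    have h1 : (5 : ℤ) ∣ s ^ 2 := by
      obtain ⟨c, hc⟩ := h
      rw [coeff_add, coeff_sub, coeff_X_pow, coeff_C_mul, coeff_X_pow, coeff_C] at hc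
      norm_num at hc
      exact ⟨c, by linarith⟩
    have h2 := Int.natCast_dvd_natCast.mp (hprime.dvd_of_dvd_pow h1)
    have := Nat.eq_one_of_dvd_coprimes h5 dvd_rfl h2
    omega

theorem aeval_goldenPoly {A : Type*} [CommRing A] (x : A) (s : ℕ) :
    aeval x (goldenPoly s) = x ^ 4 - 5 * s * x ^ 2 + 5 * s ^ 2 := by
  simp [goldenPoly, map_ofNat]

theorem aeval_goldenSqrt_goldenPoly (s : ℕ) : aeval (goldenSqrt s) (goldenPoly s) = 0 := by
  rw [aeval_goldenPoly]
  linear_combination (goldenSqrt s ^ 2 + s * (Real.goldenRatio + 2) - 5 * s) * goldenSqrt_sq s +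
    s ^ 2 * Real.goldenRatio_sq

theorem minpoly_goldenSqrt {s : ℕ} (h5 : Nat.Coprime 5 s) :
    minpoly ℚ (goldenSqrt s) = (goldenPoly s).map (Int.castRingHom ℚ) := by
  symm
  refine minpoly.eq_of_irreducible_of_monic ?_ ?_ ((monic_goldenPoly s).map _)
  · exact ((monic_goldenPoly s).irreducible_iff_irreducible_map_fraction_map (K := ℚ)).mp
      (irreducible_goldenPoly h5)
  · exact (aeval_map_algebraMap ℚ _ _).trans (aeval_goldenSqrt_goldenPoly s)

theorem isIntegral_goldenSqrt (s : ℕ) : IsIntegral ℚ (goldenSqrt s) :=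
  IsIntegral.tower_top (R := ℤ)
    ⟨goldenPoly s, monic_goldenPoly s, aeval_goldenSqrt_goldenPoly s⟩

/-- The automorphism exists because `β(w - 1)` has square `s(3 - w)`, the conjugate of `β²`, and so
is a root of the same minimal polynomial. Taking `L` with an equation lets the result apply to
`quarticField k` with its own instance. -/
theorem nonempty_goldenQuartic {s : ℕ} (hs : 0 < s) (h5 : Nat.Coprime 5 s)
    (L : IntermediateField ℚ ℝ) [NumberField L] (hL : L = ℚ⟮goldenSqrt s⟯) :
    Nonempty (GoldenQuartic L s) := by
  subst hL
  have hs0 : (s : ℝ) ≠ 0 := by exact_mod_cast hs.ne'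
  have hs1 : (s : ℚ⟮goldenSqrt s⟯) ≠ 0 := by exact_mod_cast hs.ne'
  have hint := isIntegral_goldenSqrt s
  have hφ := Real.goldenRatio_sq
  set β : ℚ⟮goldenSqrt s⟯ := AdjoinSimple.gen ℚ (goldenSqrt s) with hβ
  have hβc : ((β : ℚ⟮goldenSqrt s⟯) : ℝ) = goldenSqrt s := rfl
  obtain ⟨w, hw⟩ : ∃ w, w = β ^ 2 / s - 2 := ⟨_, rfl⟩
  have hwc : (w : ℝ) = Real.goldenRatio := by
    rw [hw]
    push_cast
    rw [hβc, goldenSqrt_sq, show ((2 : ℚ⟮goldenSqrt s⟯) : ℝ) = 2 from rfl]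
    field_simp
    ring
  have hβsq : β ^ 2 = s * (w + 2) := by
    rw [hw]
    field_simp
    ring
  have hwsq : w ^ 2 = w + 1 := by
    apply Subtype.ext
    push_cast
    rw [hwc, hφ]
  have hroot : aeval (β * (w - 1)) (minpoly ℚ (goldenSqrt s)) = 0 := by
    rw [minpoly_goldenSqrt h5]
    refine (aeval_map_algebraMap ℚ _ _).trans ?_
    rw [aeval_goldenPoly]
    linear_combination ((β ^ 2 + s * (w + 2)) * (w - 1) ^ 4 - 5 * s * (w - 1) ^ 2) * hβsq +
      (s ^ 2 * ((w ^ 2 - w - 1) * (w + 1) ^ 2 + 2 * (w + 1) * (3 - w) - 5 * (w + 1) + 1)) * hwsq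
  have hne : minpoly ℚ (goldenSqrt s) ≠ 0 := minpoly.ne_zero hint
  let f : ℚ⟮goldenSqrt s⟯ →ₐ[ℚ] ℚ⟮goldenSqrt s⟯ :=
    (algHomAdjoinIntegralEquiv ℚ hint).symm ⟨β * (w - 1), mem_aroots.mpr ⟨hne, hroot⟩⟩
  have hf : f β = β * (w - 1) := algHomAdjoinIntegralEquiv_symm_apply_gen ℚ hint _
  let σ := AlgEquiv.ofBijective f (Algebra.IsAlgebraic.algHom_bijective f)
  have hσ : σ β = β * (w - 1) := hf
  refine ⟨{
    w := w
    β := β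
    σ := σ
    ι := (ℚ⟮goldenSqrt s⟯).val.toRingHom
    w_sq := hwsq
    β_sq := hβsq
    σ_w := ?_
    σ_β := hσ
    exists_coords := ?_
    ι_w := hwc
    ι_β_pos := goldenSqrt_pos hs
    finrank_eq := ?_ }⟩
  · have h1 : σ w = σ β ^ 2 / s - 2 := by
      rw [hw, map_sub, map_div₀, map_pow, map_natCast, map_ofNat]
    rw [h1, hσ, mul_pow, hβsq]
    field_simp
    linear_combination (w + 1) * hwsq
  · intro x
    obtain ⟨p, hp, hx⟩ := (adjoin.powerBasis hint).exists_eq_aeval x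
    rw [adjoin.powerBasis_dim, minpoly_goldenSqrt h5, (monic_goldenPoly s).natDegree_map,
      natDegree_goldenPoly] at hp
    rw [adjoin.powerBasis_gen, ← hβ, aeval_eq_sum_range' hp] at hx
    -- Substitute `β² = s(w + 2)` and `β³ = s(w + 2)β` in the power basis expansion.
    refine ⟨p.coeff 0 + 2 * s * p.coeff 2, s * p.coeff 2, p.coeff 1 + 2 * s * p.coeff 3,
      s * p.coeff 3, ?_⟩
    rw [hx]
    simp only [Finset.sum_range_succ, Finset.sum_range_zero, Algebra.smul_def, eq_ratCast]
    push_cast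
    linear_combination (p.coeff 2 + p.coeff 3 * β) * hβsq
  · rw [adjoin.finrank hint, minpoly_goldenSqrt h5, (monic_goldenPoly s).natDegree_map,
      natDegree_goldenPoly]

theorem adjoin_goldenSqrt_four_mul (s : ℕ) : ℚ⟮goldenSqrt (4 * s)⟯ = ℚ⟮goldenSqrt s⟯ := by
  have h : goldenSqrt (4 * s) = 2 * goldenSqrt s := by
    have h4 : (4 : ℝ) = 2 ^ 2 := by norm_num
    rw [goldenSqrt, goldenSqrt, Nat.cast_mul, mul_assoc, Nat.cast_ofNat, h4,
      Real.sqrt_mul (by norm_num), Real.sqrt_sq (by norm_num)]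
  apply le_antisymm
  · rw [adjoin_simple_le_iff, h]
    exact mul_mem (ofNat_mem _ 2) (mem_adjoin_simple_self ℚ _)
  · rw [adjoin_simple_le_iff, show goldenSqrt s = goldenSqrt (4 * s) / 2 by rw [h]; ring]
    exact div_mem (mem_adjoin_simple_self ℚ _) (ofNat_mem _ 2)

theorem sqrt_five_mem_adjoin_goldenSqrt {s : ℕ} (hs : 0 < s) : √5 ∈ ℚ⟮goldenSqrt s⟯ := by
  have hs0 : (s : ℝ) ≠ 0 := by exact_mod_cast hs.ne'
  have h : √5 = 2 * (goldenSqrt s ^ 2 / s) - 5 := by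
    rw [goldenSqrt_sq, Real.goldenRatio]
    field_simp
    ring
  rw [h]
  exact sub_mem (mul_mem (ofNat_mem _ 2)
    (div_mem (pow_mem (mem_adjoin_simple_self ℚ _) 2) (IntermediateField.natCast_mem _ s)))
    (ofNat_mem _ 5)

theorem adjoin_goldenSqrt_five_mul {s : ℕ} (hs : 0 < s) :
    ℚ⟮goldenSqrt (5 * s)⟯ = ℚ⟮goldenSqrt s⟯ := by
  have h : goldenSqrt (5 * s) = √5 * goldenSqrt s := by
    rw [goldenSqrt, goldenSqrt, Nat.cast_mul, mul_assoc, Nat.cast_ofNat,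
      Real.sqrt_mul (by norm_num)]
  apply le_antisymm
  · rw [adjoin_simple_le_iff, h]
    exact mul_mem (sqrt_five_mem_adjoin_goldenSqrt hs) (mem_adjoin_simple_self ℚ _)
  · rw [adjoin_simple_le_iff, show goldenSqrt s = goldenSqrt (5 * s) / √5 by
      rw [h]; field_simp]
    exact div_mem (mem_adjoin_simple_self ℚ _) (sqrt_five_mem_adjoin_goldenSqrt (by omega))

theorem quarticField_eq_adjoin_goldenSqrt (k : ℕ) :
    quarticField k = ℚ⟮goldenSqrt (2 * k)⟯ := by
  have h : √((k : ℝ) * (5 + √5)) = goldenSqrt (2 * k) := by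
    rw [goldenSqrt, Real.goldenRatio]
    congr 1
    push_cast
    ring
  rw [quarticField, h]

/-- Every `quarticField k` is of the form `ℚ(√(s(φ + 2)))` with `s` square-free and prime
to 5. -/
theorem exists_quarticField_eq_adjoin {k : ℕ} (hk : Squarefree k) :
    ∃ s : ℕ, Squarefree s ∧ Nat.Coprime 5 s ∧ k ≤ 10 * s ∧
      quarticField k = ℚ⟮goldenSqrt s⟯ := by
  obtain ⟨u, hu, hku, h⟩ : ∃ u : ℕ, Squarefree u ∧ k ≤ 2 * u ∧
      quarticField k = ℚ⟮goldenSqrt u⟯ := by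
    rw [quarticField_eq_adjoin_goldenSqrt]
    -- For `k = 2j` the factor 4 of `2k = 4j` is dropped; for odd `k` the number `2k` is already
    -- square-free.
    rcases Nat.even_or_odd k with ⟨j, rfl⟩ | hodd
    · refine ⟨j, hk.squarefree_of_dvd ⟨2, by ring⟩, by omega, ?_⟩
      rw [show 2 * (j + j) = 4 * j by ring, adjoin_goldenSqrt_four_mul]
    · exact ⟨2 * k, (Nat.squarefree_mul (Nat.coprime_two_left.mpr hodd)).mpr
        ⟨Nat.prime_two.prime.squarefree, hk⟩, by omega, rfl⟩
  by_cases h5 : 5 ∣ u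
  · obtain ⟨s, rfl⟩ := h5
    have hs0 : 0 < s := Nat.pos_of_ne_zero fun h0 => hu.ne_zero (by simp [h0])
    exact ⟨s, hu.squarefree_of_dvd (Dvd.intro_left 5 rfl), Nat.coprime_of_squarefree_mul hu,
      by omega, h.trans (adjoin_goldenSqrt_five_mul hs0)⟩
  · exact ⟨u, hu, (Nat.Prime.coprime_iff_not_dvd Nat.prime_five).mpr h5, by omega, h⟩

theorem quarticField_properties {k : ℕ} (hk : Squarefree k) :
    Module.finrank ℚ (quarticField k) = 4 ∧
      NumberField.IsTotallyReal (quarticField k) ∧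
      IsGalois ℚ (quarticField k) ∧
      IsCyclic (quarticField k ≃ₐ[ℚ] quarticField k) ∧
      IsLeast (integralGeneratorMahlerMeasures (quarticField k))
        (minIntegralMahlerMeasure (quarticField k)) ∧
      (1 / 1920 : ℝ) * absDiscr (quarticField k) ^ (1 / 2 : ℝ) ≤
        minIntegralMahlerMeasure (quarticField k) ∧
      minIntegralMahlerMeasure (quarticField k) ≤ absDiscr (quarticField k) ^ (1 / 2 : ℝ) ∧
      (k : ℝ) ^ 2 ≤ absDiscr (quarticField k) := by
  obtain ⟨s, hs, h5, hks, h⟩ := exists_quarticField_eq_adjoin hk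
  obtain ⟨G⟩ := nonempty_goldenQuartic (Nat.pos_of_ne_zero hs.ne_zero) h5 _ h
  obtain ⟨h1, h2, h3, h4⟩ := G.minIntegralMahlerMeasure_bounds hs h5
  refine ⟨G.finrank_eq, G.isTotallyReal, G.isGalois, G.isCyclic_gal, h1, ?_, h3, ?_⟩
  · have : 0 ≤ absDiscr (quarticField k) ^ (1 / 2 : ℝ) :=
      Real.rpow_nonneg (abs_nonneg _) _
    linarith
  · have : (k : ℝ) ≤ 10 * s := by exact_mod_cast hks
    have h0 : (0 : ℝ) ≤ k := by positivity
    nlinarith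

end

/-! ### The family and the sharpness of the exponent -/

theorem theorem5p3 :
    -- there are infinitely many admissible `k`
    {k : ℕ | 0 < k ∧ Squarefree k}.Infinite ∧
    -- each `K_k` is a totally real cyclic quartic field, `M(𝓞 K_k)` is an attained minimum,
    -- and it satisfies the two bounds
    (∀ k : ℕ, 0 < k → Squarefree k →
      Module.finrank ℚ (quarticField k) = 4 ∧
      NumberField.IsTotallyReal (quarticField k) ∧
      IsGalois ℚ (quarticField k) ∧
      IsCyclic (quarticField k ≃ₐ[ℚ] quarticField k) ∧
      IsLeast (integralGeneratorMahlerMeasures (quarticField k))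
        (minIntegralMahlerMeasure (quarticField k)) ∧
      (1 / 1920 : ℝ) * absDiscr (quarticField k) ^ (1 / 2 : ℝ) ≤
        minIntegralMahlerMeasure (quarticField k) ∧
      minIntegralMahlerMeasure (quarticField k) ≤ absDiscr (quarticField k) ^ (1 / 2 : ℝ)) ∧
    -- the family is infinite: the discriminants take infinitely many values
    {d : ℝ | ∃ k : ℕ, 0 < k ∧ Squarefree k ∧ d = absDiscr (quarticField k)}.Infinite ∧
    -- the exponent `1/2` in the upper bound cannot be lowered, even along this family
    (∀ θ : ℝ, θ < 1 / 2 → ∀ C : ℝ, ∃ k : ℕ, 0 < k ∧ Squarefree k ∧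
      C * absDiscr (quarticField k) ^ θ < minIntegralMahlerMeasure (quarticField k)) := by
  have hlarge (B : ℝ) : ∃ k : ℕ, 0 < k ∧ Squarefree k ∧ B < absDiscr (quarticField k) := by
    obtain ⟨N, hN⟩ := exists_nat_gt B
    obtain ⟨k, hk, hkp⟩ := Nat.exists_infinite_primes N
    refine ⟨k, hkp.pos, hkp.prime.squarefree, ?_⟩
    have h := (quarticField_properties hkp.prime.squarefree).2.2.2.2.2.2.2
    have h1 : (1 : ℝ) ≤ k := by exact_mod_cast hkp.pos
    have h2 : (N : ℝ) ≤ k := by exact_mod_cast hk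
    nlinarith
  refine ⟨?_, ?_, ?_, ?_⟩
  · exact Nat.infinite_setOfPred_prime.mono fun p hp => ⟨hp.pos, hp.prime.squarefree⟩
  · intro k _ hk
    obtain ⟨h1, h2, h3, h4, h5, h6, h7, -⟩ := quarticField_properties hk
    exact ⟨h1, h2, h3, h4, h5, h6, h7⟩
  · intro hfin
    obtain ⟨B, hB⟩ := hfin.bddAbove
    obtain ⟨k, hk0, hk, hlt⟩ := hlarge B
    exact (hB ⟨k, hk0, hk, rfl⟩).not_gt hlt
  · intro θ hθ c
    obtain ⟨B, hB⟩ := Filter.eventually_atTop.mp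
      ((tendsto_rpow_atTop (sub_pos.mpr hθ)).eventually_gt_atTop (1920 * c))
    -- `D > B` gives `D^(1/2 - θ) > 1920c`, which absorbs the constant of the lower bound; the 1
    -- keeps `D` positive.
    obtain ⟨k, hk0, hk, hlt⟩ := hlarge (max B 1)
    refine ⟨k, hk0, hk, lt_of_lt_of_le ?_ (quarticField_properties hk).2.2.2.2.2.1⟩
    set D := absDiscr (quarticField k)
    have hD : 0 < D := by linarith [le_max_right B 1]
    have h1 := hB D (by linarith [le_max_left B 1])
    have h2 : D ^ (1 / 2 : ℝ) = D ^ (1 / 2 - θ) * D ^ θ := by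
      rw [← Real.rpow_add hD, sub_add_cancel]
    have h3 : 0 < D ^ θ := Real.rpow_pos_of_pos hD θ
    rw [h2]
    nlinarith
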